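/- For a function $f:\{0,1\}^n\to\{0,1\}$ and $J\subseteq\{1,\dots,n\}$ let $\widehat f(J)=2^{-n}\sum_{x\in\{0,1\}^n} f(x)(-1)^{\sum_{i\in J}x_i}$, where the values of $f$ are read as real numbers, and let the Fourier degree of $f$ be $\max\{|J| : \widehat f(J)\neq 0\}$ (and $0$ if $f=0$). Let $|\psi_f\rangle=2^{-n/2}\sum_{x\in\{0,1\}^n}(-1)^{f(x)}|x\rangle$ be the binary phase state of $f$. Theorem. $\widetilde O(2^{2d})$ copies of $|\psi_f\rangle$ suffice to identify an unknown $f$ of Fourier degree at most $d$, up to replacing $f$ by its complement $1-f$, with probability at least $2/3$, where $\widetilde O$ hides factors polynomial in $d$ and nothing depending on $n$. Precisely: there are absolute constants $C,a\in\mathbb N$ such that for all integers $n,d\ge 0$ and every integer $M\ge C\,(d+1)^a\,2^{2d}$ there is a quantum measurement (POVM) $\{E_g\}$ on $\big((\mathbb C^2)^{\otimes n}\big)^{\otimes M}$, indexed by the functions $g:\{0,1\}^n\to\{0,1\}$, such that for every $f:\{0,1\}^n\to\{0,1\}$ of Fourier degree at most $d$ the outcome $g$ of measuring $|\psi_f\rangle^{\otimes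 M}$ satisfies $g\in\{f,1-f\}$ with probability at least $2/3$. -/

import Mathlib

namespace PhaseState

open scoped ComplexOrder

/-- The cube `{0,1}^n`; `true` is the bit `1`. -/
abbrev Cube (n : ℕ) : Type := Fin n → Bool

/-- The character `χ_J(x) = (-1)^(∑_{i ∈ J} x_i)`. -/
def character {n : ℕ} (J : Finset (Fin n)) (x : Cube n) : ℝ :=
  (-1) ^ (∑ i ∈ J, (x i).toNat)

/-- The Fourier coefficient `E_x [f(x) χ_J(x)]` of `f : {0,1}^n → {0,1}`, where `x` is uniform
and the values of `f` are read as the real numbers `0` and `1`. -/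
noncomputable def coeff {n : ℕ} (f : Cube n → Bool) (J : Finset (Fin n)) : ℝ :=
  (∑ x : Cube n, ((f x).toNat : ℝ) * character J x) / 2 ^ n

open Classical in
/-- The Fourier degree `max {|J| : coeff f J ≠ 0}` (and `0` for `f = 0`). -/
noncomputable def fourierDegree {n : ℕ} (f : Cube n → Bool) : ℕ :=
  (Finset.univ.filter fun J : Finset (Fin n) => coeff f J ≠ 0).sup Finset.card

/-- The binary phase state `2^(-n/2) ∑_x (-1)^(f x) |x⟩`, by its amplitudes. -/
noncomputable def phaseState {n : ℕ} (f : Cube n → Bool) : Cube n → ℂ :=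
  fun x => (-1) ^ (f x).toNat / ((Real.sqrt (2 ^ n) : ℝ) : ℂ)

/-- The `M`-fold tensor power `ψ ⊗ ⋯ ⊗ ψ`, by its amplitudes in the product basis
`|y_1⟩ ⊗ ⋯ ⊗ |y_M⟩`. -/
def tensorPower {X : Type} (ψ : X → ℂ) (M : ℕ) : (Fin M → X) → ℂ :=
  fun y => ∏ i, ψ (y i)

/-- A measurement (POVM) on `ℂ^X` with outcomes in the finite set `O`. -/
structure POVM (X O : Type) [Fintype X] [DecidableEq X] [Fintype O] where
  elem : O → Matrix X X ℂ
  posSemidef : ∀ o, (elem o).PosSemidef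
  sum_eq_one : ∑ o, elem o = 1

/-- The probability `⟨ψ|E_o|ψ⟩` of the outcome `o` when the state `ψ` is measured. -/
noncomputable def POVM.prob {X O : Type} [Fintype X] [DecidableEq X] [Fintype O]
    (E : POVM X O) (ψ : X → ℂ) (o : O) : ℝ :=
  (star ψ ⬝ᵥ (E.elem o).mulVec ψ).re

/-- `g` and `f` are equal up to complement, that is `g = f` or `g = 1 - f`; these are exactly
the functions whose phase states agree up to a global phase. -/
def SameUpToComplement {n : ℕ} (f g : Cube n → Bool) : Prop :=
  g = f ∨ g = fun x => !(f x)

open Classical in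
/-- The probability that the measurement `E` of `M` copies of the phase state of `f`, whose
outcome is a guess for `f`, identifies `f` up to complement. -/
noncomputable def identifyProb {n M : ℕ} (E : POVM (Fin M → Cube n) (Cube n → Bool))
    (f : Cube n → Bool) : ℝ :=
  ∑ g ∈ Finset.univ.filter (fun g => SameUpToComplement f g),
    E.prob (tensorPower (phaseState f) M) g

end PhaseState

/-! Write `F = (-1)^f`. In the Fourier basis the phase state has as amplitudes the Fourier
coefficients of `F`, which determine `f`; a global sign of `F` is complementation. Degree at most
`d` makes them integer multiples of `2^(-d)` (`amp_mul_two_pow_mem`), so by Parseval at most `4^d`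
are nonzero, each of weight at least `4^(-d)`. Measuring about `d * 4^d` copies in the Fourier basis
therefore reveals the whole support (`five_sixths_le_support`).

A cycle `σ` is then put through the observed support, and the other copies are measured with vectors
proportional to `2 e_T` and `e_T ± e_(σ T)`. The values of `F_T ^ 2` and `(F_T + F_(σ T)) ^ 2` give
the relative signs of neighbours on the cycle, hence `F` up to a global sign
(`sameUpToComplement_of_cycle`).

These values are recovered exactly because the square roots of the outcome probabilities lie on a
grid of spacing of order `2^(-d)`. The error of a likelihood test is governed by the squared
distance of these square roots (`sum_filter_likelihood_le`), so order `4^d` copies per unit of error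
exponent suffice, even for small probabilities. A union bound over order `8^d` tests costs a factor
`d + 1`. Nothing depends on `n`. -/

namespace PhaseState

/-! ### Fourier analysis of Boolean functions -/

/-- The sign `(-1)^b` of a bit. -/
def bitSign (b : Bool) : ℝ := (-1) ^ b.toNat

lemma bitSign_mul_self (b : Bool) : bitSign b * bitSign b = 1 := by
  cases b <;> simp [bitSign]

lemma character_eq_prod {n : ℕ} (J : Finset (Fin n)) (x : Cube n) :
    character J x = ∏ i ∈ J, bitSign (x i) := by
  simp only [character, bitSign, Finset.prod_pow_eq_pow_sum]

lemma sum_character_mul_character {n : ℕ} (x y : Cube n) :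
    ∑ J : Finset (Fin n), character J x * character J y = if x = y then 2 ^ n else 0 := by
  have h : ∑ J : Finset (Fin n), character J x * character J y
      = ∏ i : Fin n, (1 + bitSign (x i) * bitSign (y i)) := by
    rw [Finset.prod_one_add, Finset.powerset_univ]
    simp only [character_eq_prod, Finset.prod_mul_distrib]
  rw [h]
  split_ifs with hxy
  · subst hxy
    simp only [bitSign_mul_self]
    norm_num
  · obtain ⟨i, hi⟩ := Function.ne_iff.mp hxy
    refine Finset.prod_eq_zero (Finset.mem_univ i) ?_
    revert hi
    cases x i <;> cases y i <;> simp [bitSign]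

/-- The Fourier coefficient `E_x [(-1)^(f x) χ_J(x)]` of the sign function of `f`. -/
noncomputable def amp {n : ℕ} (f : Cube n → Bool) (J : Finset (Fin n)) : ℝ :=
  (∑ x : Cube n, bitSign (f x) * character J x) / 2 ^ n

lemma sum_amp_mul_character {n : ℕ} (f : Cube n → Bool) (x : Cube n) :
    ∑ J : Finset (Fin n), amp f J * character J x = bitSign (f x) := by
  have h : ∑ J : Finset (Fin n), amp f J * character J x
      = (∑ y : Cube n, bitSign (f y) * ∑ J, character J y * character J x) / 2 ^ n := by
    simp only [amp, Finset.mul_sum, Finset.sum_div, Finset.sum_mul]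
    rw [Finset.sum_comm]
    refine Finset.sum_congr rfl fun y _ => Finset.sum_congr rfl fun J _ => by ring
  rw [h]
  simp [sum_character_mul_character]

lemma sum_amp_sq {n : ℕ} (f : Cube n → Bool) : ∑ J : Finset (Fin n), amp f J ^ 2 = 1 := by
  have h : ∑ J : Finset (Fin n), amp f J ^ 2
      = (∑ x : Cube n, bitSign (f x) * ∑ J, amp f J * character J x) / 2 ^ n := by
    simp only [Finset.mul_sum]
    rw [Finset.sum_comm, Finset.sum_div]
    refine Finset.sum_congr rfl fun J _ => ?_
    rw [sq]
    nth_rewrite 1 [amp]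
    rw [div_mul_eq_mul_div, Finset.sum_mul]
    congr 1
    exact Finset.sum_congr rfl fun x _ => by ring
  rw [h]
  simp [sum_amp_mul_character, bitSign_mul_self]

lemma bitSign_injective : Function.Injective bitSign := by
  intro a b
  cases a <;> cases b <;> norm_num [bitSign]

lemma sameUpToComplement_of_amp {n : ℕ} {f g : Cube n → Bool}
    (h : amp g = amp f ∨ amp g = -amp f) : SameUpToComplement f g := by
  rcases h with h | h
  · left
    funext x
    apply bitSign_injective
    rw [← sum_amp_mul_character g, h, sum_amp_mul_character]
  · right
    funext x
    apply bitSign_injective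
    have h2 : bitSign (!(f x)) = -bitSign (f x) := by cases f x <;> simp [bitSign]
    rw [h2, ← sum_amp_mul_character g, h, ← sum_amp_mul_character f, ← Finset.sum_neg_distrib]
    simp

lemma sum_character {n : ℕ} (J : Finset (Fin n)) :
    ∑ x : Cube n, character J x = if J = ∅ then 2 ^ n else 0 := by
  have h : ∑ x : Cube n, character J x
      = ∏ i : Fin n, ∑ b : Bool, (if i ∈ J then bitSign b else 1) := by
    rw [Finset.prod_univ_sum]
    simp only [Fintype.piFinset_univ, character_eq_prod]
    refine Finset.sum_congr rfl fun x _ => ?_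
    rw [Finset.prod_ite_mem, Finset.univ_inter]
  rw [h]
  split_ifs with hJ
  · simp [hJ]
  · obtain ⟨i, hi⟩ := Finset.nonempty_iff_ne_empty.mpr hJ
    refine Finset.prod_eq_zero (Finset.mem_univ i) ?_
    simp [hi, bitSign]

lemma amp_eq {n : ℕ} (f : Cube n → Bool) (J : Finset (Fin n)) :
    amp f J = (if J = ∅ then 1 else 0) - 2 * coeff f J := by
  have h : ∀ b : Bool, bitSign b = 1 - 2 * (b.toNat : ℝ) := by
    intro b
    cases b <;> norm_num [bitSign]
  have h1 : ∑ x : Cube n, bitSign (f x) * character J x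
      = ∑ x : Cube n, character J x - 2 * ∑ x : Cube n, ((f x).toNat : ℝ) * character J x := by
    rw [Finset.mul_sum, ← Finset.sum_sub_distrib]
    exact Finset.sum_congr rfl fun x _ => by rw [h]; ring
  rw [amp, h1, sum_character, coeff, sub_div]
  split_ifs <;> simp [mul_div_assoc]

/-- The real numbers that are integers. -/
def intReals : AddSubgroup ℝ := (Int.castAddHom ℝ).range

lemma mem_intReals {r : ℝ} : r ∈ intReals ↔ ∃ z : ℤ, (z : ℝ) = r := by
  exact Iff.rfl

/-- Summed over `I ⊇ J`, the characters factor over coordinates: a sign for `i ∈ J`, and `1` plus a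
sign, that is `0` or `2`, for `i ∉ J`. The sum is thus divisible by `2^(n - |J|)`, which leaves only
`2^|J|` in the denominator. -/
lemma sum_superset_coeff_mem {n : ℕ} (f : Cube n → Bool) (J : Finset (Fin n)) :
    (∑ I ∈ Finset.univ.filter (J ⊆ ·), coeff f I) * 2 ^ J.card ∈ intReals := by
  have hchar : ∀ x : Cube n, ∑ I ∈ Finset.univ.filter (J ⊆ ·), character I x
      = ∏ i, (bitSign (x i) + if i ∈ J then 0 else 1) := by
    intro x
    rw [Finset.prod_add, Finset.powerset_univ, Finset.sum_filter]
    refine Finset.sum_congr rfl fun I _ => ?_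
    split_ifs with h
    · rw [character_eq_prod, Finset.prod_eq_one (s := Finset.univ \ I), mul_one]
      intro i hi
      rw [if_neg fun hJ => (Finset.mem_sdiff.mp hi).2 (h hJ)]
    · obtain ⟨i, hi, hI⟩ := Finset.not_subset.mp h
      rw [Finset.prod_eq_zero (s := Finset.univ \ I) (i := i), mul_zero]
      · simp [hI]
      · simp [hi]
  have hint : ∀ x : Cube n, ∃ z : ℤ,
      (∏ i, (bitSign (x i) + if i ∈ J then 0 else 1)) * 2 ^ J.card = (z : ℝ) * 2 ^ n := by
    intro x
    refine ⟨∏ i, if i ∈ J then (if x i then -1 else 1) else (if x i then 0 else 1), ?_⟩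
    have h2 : (2 : ℝ) ^ J.card = ∏ i : Fin n, if i ∈ J then 2 else 1 := by
      rw [Finset.prod_ite_mem, Finset.univ_inter, Finset.prod_const]
    have h3 : (2 : ℝ) ^ n = ∏ _i : Fin n, 2 := by simp
    rw [h2, h3, Int.cast_prod, ← Finset.prod_mul_distrib, ← Finset.prod_mul_distrib]
    refine Finset.prod_congr rfl fun i _ => ?_
    by_cases hi : i ∈ J <;> cases x i <;> norm_num [bitSign, hi]
  choose z hz using hint
  refine mem_intReals.mpr ⟨∑ x, ((f x).toNat : ℤ) * z x, ?_⟩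
  simp only [coeff]
  rw [← Finset.sum_div, Finset.sum_comm, div_mul_eq_mul_div, eq_div_iff (by positivity)]
  push_cast
  rw [Finset.sum_mul, Finset.sum_mul]
  refine Finset.sum_congr rfl fun x _ => ?_
  rw [← Finset.mul_sum, hchar, mul_assoc, mul_assoc, hz]

lemma coeff_eq_zero_of_lt {n d : ℕ} {f : Cube n → Bool} (hf : fourierDegree f ≤ d)
    {J : Finset (Fin n)} (hJ : d < J.card) : coeff f J = 0 := by
  classical
  by_contra h
  have : J.card ≤ fourierDegree f := by
    unfold fourierDegree
    exact Finset.le_sup (f := Finset.card) (Finset.mem_filter.mpr ⟨Finset.mem_univ _, h⟩)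
  omega

/-- Downward induction on `|J|`: the sum over all supersets of `J` is controlled by
`sum_superset_coeff_mem`, and the proper supersets by induction. -/
lemma coeff_mul_two_pow_mem {n d : ℕ} {f : Cube n → Bool} (hf : fourierDegree f ≤ d)
    (J : Finset (Fin n)) : coeff f J * 2 ^ d ∈ intReals := by
  induction hk : n - J.card using Nat.strong_induction_on generalizing J with
  | _ k ih =>
  by_cases hJ : d < J.card
  · rw [coeff_eq_zero_of_lt hf hJ, zero_mul]
    exact zero_mem _
  have hsplit := Finset.add_sum_erase (Finset.univ.filter (J ⊆ ·)) (coeff f)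
    (Finset.mem_filter.mpr ⟨Finset.mem_univ J, subset_rfl⟩)
  have h1 : (∑ I ∈ Finset.univ.filter (J ⊆ ·), coeff f I) * 2 ^ d ∈ intReals := by
    obtain ⟨z, hz⟩ := mem_intReals.mp (sum_superset_coeff_mem f J)
    refine mem_intReals.mpr ⟨z * 2 ^ (d - J.card), ?_⟩
    push_cast
    rw [hz, mul_assoc, ← pow_add, Nat.add_sub_cancel' (not_lt.mp hJ)]
  have h2 : (∑ I ∈ (Finset.univ.filter (J ⊆ ·)).erase J, coeff f I) * 2 ^ d ∈ intReals := by
    rw [Finset.sum_mul]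
    refine sum_mem fun I hI => ?_
    obtain ⟨hne, hI⟩ := Finset.mem_erase.mp hI
    have hlt := Finset.card_lt_card ((Finset.mem_filter.mp hI).2.ssubset_of_ne hne.symm)
    have hle : I.card ≤ n := by simpa using I.card_le_univ
    exact ih (n - I.card) (by omega) I rfl
  have h3 : coeff f J * 2 ^ d = (∑ I ∈ Finset.univ.filter (J ⊆ ·), coeff f I) * 2 ^ d
      - (∑ I ∈ (Finset.univ.filter (J ⊆ ·)).erase J, coeff f I) * 2 ^ d := by
    rw [← hsplit]
    ring
  rw [h3]
  exact sub_mem h1 h2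

/-- The Fourier coefficients of the sign function of a function of degree `d` are integer
multiples of `2^(-d)`. -/
lemma amp_mul_two_pow_mem {n d : ℕ} {f : Cube n → Bool} (hf : fourierDegree f ≤ d)
    (J : Finset (Fin n)) : amp f J * 2 ^ d ∈ intReals := by
  obtain ⟨z, hz⟩ := mem_intReals.mp (coeff_mul_two_pow_mem hf J)
  refine mem_intReals.mpr ⟨(if J = ∅ then 2 ^ d else 0) - 2 * z, ?_⟩
  push_cast
  rw [hz, amp_eq]
  split_ifs <;> ring

lemma abs_amp_le_one {n : ℕ} (f : Cube n → Bool) (J : Finset (Fin n)) : |amp f J| ≤ 1 := by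
  rw [← sq_le_one_iff_abs_le_one, ← sum_amp_sq f]
  exact Finset.single_le_sum (f := fun J => amp f J ^ 2) (fun _ _ => sq_nonneg _)
    (Finset.mem_univ J)

open Classical in
/-- The Fourier support of the sign function of `f`. -/
noncomputable def ampSupport {n : ℕ} (f : Cube n → Bool) : Finset (Finset (Fin n)) :=
  Finset.univ.filter fun J => amp f J ≠ 0

lemma mem_ampSupport {n : ℕ} {f : Cube n → Bool} {J : Finset (Fin n)} :
    J ∈ ampSupport f ↔ amp f J ≠ 0 := by
  simp [ampSupport]

lemma le_amp_sq {n d : ℕ} {f : Cube n → Bool} (hf : fourierDegree f ≤ d)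
    {J : Finset (Fin n)} (hJ : J ∈ ampSupport f) : ((4 : ℝ) ^ d)⁻¹ ≤ amp f J ^ 2 := by
  obtain ⟨z, hz⟩ := mem_intReals.mp (amp_mul_two_pow_mem hf J)
  have hz0 : z ≠ 0 := by
    rintro rfl
    have : amp f J * 2 ^ d ≠ 0 := mul_ne_zero (mem_ampSupport.mp hJ) (by positivity)
    exact this (by rw [← hz, Int.cast_zero])
  have h1 : (1 : ℝ) ≤ (z : ℝ) ^ 2 := by
    exact_mod_cast (one_le_sq_iff_one_le_abs z).mpr (Int.one_le_abs hz0)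
  have h4 : (4 : ℝ) ^ d = (2 ^ d) ^ 2 := by rw [← pow_mul, mul_comm, pow_mul]; norm_num
  rw [inv_le_iff_one_le_mul₀ (by positivity), h4, ← mul_pow, ← hz]
  exact h1

lemma card_ampSupport_le {n d : ℕ} {f : Cube n → Bool} (hf : fourierDegree f ≤ d) :
    ((ampSupport f).card : ℝ) ≤ 4 ^ d := by
  have h1 : ((ampSupport f).card : ℝ) * ((4 : ℝ) ^ d)⁻¹ ≤ 1 := by
    rw [← nsmul_eq_mul, ← sum_amp_sq f]
    exact (Finset.card_nsmul_le_sum _ _ _ fun J hJ => le_amp_sq hf hJ).trans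
      (Finset.sum_le_sum_of_subset_of_nonneg (Finset.subset_univ _) fun _ _ _ => sq_nonneg _)
  rwa [← div_eq_mul_inv, div_le_one (by positivity)] at h1

/-- Squares of the coefficients and of the sums of coefficients that are neighbours on a cycle
through the Fourier support determine the function up to complement. -/
lemma sameUpToComplement_of_cycle {n : ℕ} {f g : Cube n → Bool}
    {σ : Equiv.Perm (Finset (Fin n))} (hσ : σ.IsCycleOn (ampSupport f))
    (hs : ampSupport g = ampSupport f)
    (h1 : ∀ T ∈ ampSupport f, amp g T ^ 2 = amp f T ^ 2)
    (h2 : ∀ T ∈ ampSupport f, (amp g T + amp g (σ T)) ^ 2 = (amp f T + amp f (σ T)) ^ 2) :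
    SameUpToComplement f g := by
  have hmem : ∀ T ∈ ampSupport f, σ T ∈ ampSupport f := fun T hT => hσ.apply_mem_iff.mpr hT
  have hzero : ∀ T, T ∉ ampSupport f → amp g T = 0 ∧ amp f T = 0 := by
    intro T hT
    have hT' := hT
    rw [← hs] at hT'
    rw [mem_ampSupport, not_not] at hT hT'
    exact ⟨hT', hT⟩
  -- The squares at `T`, at `σ T` and of the sum fix the product of the two coefficients. Neither
  -- vanishes for `f`, so a sign `ε` passes between neighbours.
  have hstep : ∀ ε : ℝ, ε ^ 2 = 1 → ∀ T ∈ ampSupport f,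
      (amp g T = ε * amp f T ↔ amp g (σ T) = ε * amp f (σ T)) := by
    intro ε hε T hT
    have ha := h1 T hT
    have hb := h1 _ (hmem T hT)
    have hc := h2 T hT
    have hprod : amp g T * amp g (σ T) = amp f T * amp f (σ T) := by linarith
    have n1 := mem_ampSupport.mp hT
    have n2 := mem_ampSupport.mp (hmem T hT)
    constructor
    · intro h
      rw [h] at hprod
      have : amp f T * (ε * amp g (σ T) - amp f (σ T)) = 0 := by linarith
      rcases mul_eq_zero.mp this with h0 | h0
      · exact absurd h0 n1
      · linear_combination ε * h0 - amp g (σ T) * hε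
    · intro h
      rw [h] at hprod
      have : amp f (σ T) * (ε * amp g T - amp f T) = 0 := by linarith
      rcases mul_eq_zero.mp this with h0 | h0
      · exact absurd h0 n2
      · linear_combination ε * h0 - amp g T * hε
  have hall : ∀ ε : ℝ, ε ^ 2 = 1 → ∀ T ∈ ampSupport f, amp g T = ε * amp f T →
      ∀ U, amp g U = ε * amp f U := by
    intro ε hε T hT h U
    by_cases hU : U ∈ ampSupport f
    · obtain ⟨k, -, rfl⟩ := hσ.exists_pow_eq hT hU
      clear hU
      induction k with
      | zero => simpa using h
      | succ k ih =>
        rw [pow_succ', Equiv.Perm.mul_apply]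
        exact (hstep ε hε _ ((hσ.1.perm_pow k).mapsTo hT)).mp ih
    · rw [(hzero U hU).1, (hzero U hU).2, mul_zero]
  apply sameUpToComplement_of_amp
  have hne : (ampSupport f).Nonempty := by
    by_contra hemp
    have : ∀ J, amp f J = 0 := fun J => (hzero J fun hJ => hemp ⟨J, hJ⟩).2
    have := sum_amp_sq f
    simp_all
  obtain ⟨T, hT⟩ := hne
  rcases sq_eq_sq_iff_eq_or_eq_neg.mp (h1 T hT) with h | h
  · left
    funext U
    simpa using hall 1 (by norm_num) T hT (by simpa using h) U
  · right
    funext U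
    simpa using hall (-1) (by norm_num) T hT (by simpa using h) U

/-! ### Measurements with rank-one elements -/

section Frame

variable {X Ω O : Type} [Fintype X] [DecidableEq X] [Fintype Ω] [Fintype O]

/-- The projections onto the lines of the real vectors `V ω` sum to the identity. -/
def IsFrame (V : Ω → X → ℝ) : Prop :=
  ∀ x y, ∑ ω, V ω x * V ω y = if x = y then 1 else 0

open Classical in
/-- The sum of the projections onto the lines of the vectors `V ω` with `dec ω = o`. -/
noncomputable def fiberMatrix (V : Ω → X → ℝ) (dec : Ω → O) (o : O) : Matrix X X ℂ :=
  ∑ ω ∈ Finset.univ.filter (dec · = o), Matrix.vecMulVec (fun x => (V ω x : ℂ))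
    (star fun x => (V ω x : ℂ))

open Classical in
omit [Fintype X] [DecidableEq X] [Fintype O] in
lemma fiberMatrix_apply (V : Ω → X → ℝ) (dec : Ω → O) (o : O) (x y : X) :
    fiberMatrix V dec o x y
      = ((∑ ω ∈ Finset.univ.filter (dec · = o), V ω x * V ω y : ℝ) : ℂ) := by
  rw [fiberMatrix, Matrix.sum_apply]
  simp [Matrix.vecMulVec_apply]

open Classical in
open scoped ComplexOrder in
/-- The measurement with outcomes `ω`, followed by the classical decoding `dec`. -/
noncomputable def POVM.ofFrame (V : Ω → X → ℝ) (hV : IsFrame V) (dec : Ω → O) : POVM X O where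
  elem := fiberMatrix V dec
  posSemidef _ := Matrix.posSemidef_sum _ fun _ _ => Matrix.posSemidef_vecMulVec_self_star _
  sum_eq_one := by
    ext x y
    rw [Matrix.sum_apply]
    simp only [fiberMatrix_apply]
    have h : ∑ o, ∑ ω ∈ Finset.univ.filter (dec · = o), V ω x * V ω y = if x = y then 1 else 0 := by
      rw [← hV x y]
      simp only [Finset.sum_filter]
      rw [Finset.sum_comm]
      simp
    rw [← Complex.ofReal_sum, h, Matrix.one_apply]
    split_ifs <;> simp

open Classical in
lemma POVM.prob_ofFrame (V : Ω → X → ℝ) (hV : IsFrame V) (dec : Ω → O) (ψ : X → ℝ) (o : O) :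
    (POVM.ofFrame V hV dec).prob (fun x => (ψ x : ℂ)) o
      = ∑ ω ∈ Finset.univ.filter (dec · = o), (∑ x, V ω x * ψ x) ^ 2 := by
  have h : star (fun x => (ψ x : ℂ)) ⬝ᵥ
      ((POVM.ofFrame V hV dec).elem o).mulVec (fun x => (ψ x : ℂ))
      = ((∑ x, ψ x * ∑ y, (∑ ω ∈ Finset.univ.filter (dec · = o), V ω x * V ω y) * ψ y : ℝ) : ℂ)
      := by
    simp only [dotProduct, Matrix.mulVec, POVM.ofFrame, fiberMatrix_apply]
    push_cast
    simp
  rw [POVM.prob, h, Complex.ofReal_re]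
  simp only [Finset.sum_mul, Finset.mul_sum, sq]
  rw [Finset.sum_congr rfl fun x _ => Finset.sum_comm, Finset.sum_comm]
  refine Finset.sum_congr rfl fun ω _ => ?_
  rw [Finset.sum_comm]
  refine Finset.sum_congr rfl fun x _ => Finset.sum_congr rfl fun y _ => by ring

lemma IsFrame.sum_sq {V : Ω → X → ℝ} (hV : IsFrame V) (ψ : X → ℝ) :
    ∑ ω, (∑ x, V ω x * ψ x) ^ 2 = ∑ x, ψ x ^ 2 := by
  have h : ∑ ω, (∑ x, V ω x * ψ x) ^ 2 = ∑ x, ∑ y, (∑ ω, V ω x * V ω y) * (ψ x * ψ y) := by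
    simp only [sq, Finset.sum_mul_sum]
    rw [Finset.sum_comm]
    refine Finset.sum_congr rfl fun x _ => ?_
    rw [Finset.sum_comm]
    refine Finset.sum_congr rfl fun y _ => ?_
    rw [Finset.sum_mul]
    exact Finset.sum_congr rfl fun ω _ => by ring
  rw [h]
  unfold IsFrame at hV
  simp [hV, sq]

end Frame

section Adaptive

variable {X A B : Type} [Fintype X] [DecidableEq X] [Fintype A] [Fintype B]

omit [Fintype X] in
lemma IsFrame.sum_prod {M : ℕ} {w : B → X → ℝ} (hw : IsFrame w) (x y : Fin M → X) :
    ∑ b : Fin M → B, (∏ j, w (b j) (x j)) * ∏ j, w (b j) (y j) = if x = y then 1 else 0 := by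
  simp only [← Finset.prod_mul_distrib]
  rw [← Fintype.piFinset_univ, ← Finset.prod_univ_sum (fun _ => Finset.univ)
    (fun j b => w b (x j) * w b (y j))]
  unfold IsFrame at hw
  simp only [hw, Finset.prod_ite_zero, Finset.prod_const_one, Finset.mem_univ, true_implies,
    funext_iff]

/-- The vectors of the measurement that measures the first `M₁` copies in the frame `u`, and the
others in a frame `w a` that depends on the outcomes `a` of the first ones. -/
def adaptiveVec {M₁ M₂ : ℕ} (u : A → X → ℝ) (w : (Fin M₁ → A) → B → X → ℝ)
    (ω : (Fin M₁ → A) × (Fin M₂ → B)) (y : Fin (M₁ + M₂) → X) : ℝ :=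
  (∏ i, u (ω.1 i) (y (Fin.castAdd M₂ i))) * ∏ j, w ω.1 (ω.2 j) (y (Fin.natAdd M₁ j))

-- For fixed `a` the sum over the second outcomes is a delta that no longer depends on `a`, so
-- adaptivity does not disturb the sum over `a`.
omit [Fintype X] in
lemma isFrame_adaptiveVec {M₁ M₂ : ℕ} {u : A → X → ℝ} (hu : IsFrame u)
    {w : (Fin M₁ → A) → B → X → ℝ} (hw : ∀ a, IsFrame (w a)) :
    IsFrame (adaptiveVec (M₂ := M₂) u w) := by
  intro x y
  simp only [adaptiveVec]
  rw [Fintype.sum_prod_type]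
  have h : ∀ a : Fin M₁ → A, ∑ b : Fin M₂ → B,
      ((∏ i, u (a i) (x (Fin.castAdd M₂ i))) * ∏ j, w a (b j) (x (Fin.natAdd M₁ j))) *
        ((∏ i, u (a i) (y (Fin.castAdd M₂ i))) * ∏ j, w a (b j) (y (Fin.natAdd M₁ j)))
      = ((∏ i, u (a i) (x (Fin.castAdd M₂ i))) * ∏ i, u (a i) (y (Fin.castAdd M₂ i))) *
        (if (fun j => x (Fin.natAdd M₁ j)) = (fun j => y (Fin.natAdd M₁ j)) then 1 else 0) := by
    intro a
    rw [← (hw a).sum_prod, Finset.mul_sum]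
    exact Finset.sum_congr rfl fun b _ => by ring
  simp only [h]
  rw [← Finset.sum_mul, hu.sum_prod (fun i => x (Fin.castAdd M₂ i)), ite_zero_mul_ite_zero,
    mul_one]
  congr 1
  rw [eq_iff_iff]
  constructor
  · rintro ⟨h1, h2⟩
    funext i
    exact Fin.addCases (fun i => congrFun h1 i) (fun j => congrFun h2 j) i
  · rintro rfl
    exact ⟨rfl, rfl⟩

omit [DecidableEq X] in
lemma sum_prod_mul_prod {M : ℕ} (v : Fin M → X → ℝ) (ψ : X → ℝ) :
    ∑ y : Fin M → X, (∏ j, v j (y j)) * ∏ j, ψ (y j) = ∏ j, ∑ x, v j x * ψ x := by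
  rw [Finset.prod_univ_sum, Fintype.piFinset_univ]
  exact Finset.sum_congr rfl fun y _ => Finset.prod_mul_distrib.symm

omit [DecidableEq X] [Fintype A] [Fintype B] in
lemma sum_adaptiveVec_mul {M₁ M₂ : ℕ} (u : A → X → ℝ) (w : (Fin M₁ → A) → B → X → ℝ)
    (ω : (Fin M₁ → A) × (Fin M₂ → B)) (ψ : X → ℝ) :
    ∑ y, adaptiveVec u w ω y * ∏ i, ψ (y i)
      = (∏ i, ∑ x, u (ω.1 i) x * ψ x) * ∏ j, ∑ x, w ω.1 (ω.2 j) x * ψ x := by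
  rw [← sum_prod_mul_prod, ← sum_prod_mul_prod, Finset.sum_mul_sum, ← Fintype.sum_prod_type',
    ← (Fin.appendEquiv M₁ M₂).sum_comp]
  refine Finset.sum_congr rfl fun p _ => ?_
  simp only [adaptiveVec, Fin.prod_univ_add, Fin.appendEquiv, Equiv.coe_fn_mk, Fin.append_left,
    Fin.append_right]
  ring

end Adaptive

/-! ### Product distributions and likelihood tests -/

section Prob

variable {ι B : Type} [Fintype B]

/-- The union bound. -/
lemma one_sub_sum_le_sum_filter {P : B → ℝ} (h0 : ∀ b, 0 ≤ P b) (h1 : ∑ b, P b = 1)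
    (s : Finset ι) (bad : ι → B → Prop) (good : B → Prop)
    [∀ i, DecidablePred (bad i)] [DecidablePred good] (h : ∀ b, (∀ i ∈ s, ¬ bad i b) → good b) :
    1 - ∑ i ∈ s, ∑ b ∈ Finset.univ.filter (bad i), P b ≤ ∑ b ∈ Finset.univ.filter good, P b := by
  have h2 : ∑ b ∈ Finset.univ.filter (fun b => ¬ good b), P b
      ≤ ∑ i ∈ s, ∑ b ∈ Finset.univ.filter (bad i), P b := by
    simp only [Finset.sum_filter]
    rw [Finset.sum_comm]
    refine Finset.sum_le_sum fun b _ => ?_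
    have hnn : ∀ i ∈ s, 0 ≤ if bad i b then P b else 0 := fun i _ => by
      split_ifs
      exacts [h0 b, le_rfl]
    by_cases hb : good b
    · rw [if_neg (not_not.mpr hb)]
      exact Finset.sum_nonneg hnn
    · rw [if_pos hb]
      have : ∃ i ∈ s, bad i b := by
        by_contra! hc
        exact hb (h b hc)
      obtain ⟨i, hi, hbi⟩ := this
      calc P b = if bad i b then P b else 0 := (if_pos hbi).symm
        _ ≤ _ := Finset.single_le_sum hnn hi
  have h3 := Finset.sum_filter_add_sum_filter_not Finset.univ good P
  linarith

lemma sum_prod_eq_one {p : B → ℝ} (h1 : ∑ b, p b = 1) (M : ℕ) :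
    ∑ b : Fin M → B, ∏ j, p (b j) = 1 := by
  rw [← Fintype.sum_pow, h1, one_pow]

lemma sum_filter_notMem_range [DecidableEq B] {p : B → ℝ} (h1 : ∑ b, p b = 1) (M : ℕ) (o : B) :
    ∑ b ∈ Finset.univ.filter (fun b : Fin M → B => ∀ j, b j ≠ o), ∏ j, p (b j)
      = (1 - p o) ^ M := by
  have h2 : ∑ b, (if b ≠ o then p b else 0) = 1 - p o := by
    rw [← h1, ← Finset.sum_filter, Finset.filter_ne', ← Finset.sum_erase_add _ _ (Finset.mem_univ o)]
    ring
  rw [← h2, Fintype.sum_pow, Finset.sum_filter]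
  refine Finset.sum_congr rfl fun b _ => ?_
  rw [Finset.prod_ite_zero]
  simp

open Classical in
/-- The likelihood of the positions of `o` in the sample `b`, if `o` has probability `α²`. -/
noncomputable def likelihood {M : ℕ} (o : B) (α : ℝ) (b : Fin M → B) : ℝ :=
  ∏ j, if b j = o then α ^ 2 else 1 - α ^ 2

lemma sqrt_mul_sqrt_le {a b : ℝ} (ha : 0 ≤ a) (hb : 0 ≤ b) : √a * √b ≤ (a + b) / 2 := by
  nlinarith [sq_nonneg (√a - √b), Real.sq_sqrt ha, Real.sq_sqrt hb]

open Classical in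
/-- The error of a likelihood test is at most the power of the Bhattacharyya coefficient. -/
lemma sum_filter_likelihood_le {p : B → ℝ} (h0 : ∀ b, 0 ≤ p b) (h1 : ∑ b, p b = 1) (M : ℕ)
    (o : B) {α β : ℝ} (hα : 0 ≤ α) (hβ : 0 ≤ β) (hβ1 : β ^ 2 ≤ 1) (hp : p o = α ^ 2) :
    ∑ b ∈ Finset.univ.filter (fun b : Fin M → B => likelihood o α b ≤ likelihood o β b),
      ∏ j, p (b j) ≤ (1 - (α - β) ^ 2 / 2) ^ M := by
  have hrest : ∑ b ∈ Finset.univ.erase o, p b = 1 - α ^ 2 := by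
    rw [← h1, ← hp, ← Finset.sum_erase_add _ _ (Finset.mem_univ o)]
    ring
  have hle : ∀ b, b ≠ o → p b ≤ 1 - α ^ 2 := fun b hb => by
    rw [← hrest]
    exact Finset.single_le_sum (fun b _ => h0 b) (Finset.mem_erase.mpr ⟨hb, Finset.mem_univ b⟩)
  have hα1 : 0 ≤ 1 - α ^ 2 := by
    rw [← hrest]
    exact Finset.sum_nonneg fun b _ => h0 b
  -- The square root of the likelihood ratio of one observation. Its product is at least `1` on
  -- samples of positive weight where the test errs, and its mean is the Bhattacharyya coefficient.
  -- Division by zero is harmless: it occurs only at outcomes of probability `0`.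
  set r : B → ℝ := fun b => if b = o then β / α else √(1 - β ^ 2) / √(1 - α ^ 2) with hr
  have hr0 : ∀ b, 0 ≤ r b := fun b => by
    simp only [hr]
    split_ifs <;> positivity
  have hsum : ∑ b, p b * r b ≤ 1 - (α - β) ^ 2 / 2 := by
    rw [← Finset.sum_erase_add _ _ (Finset.mem_univ o)]
    have e1 : ∑ b ∈ Finset.univ.erase o, p b * r b
        = (1 - α ^ 2) * (√(1 - β ^ 2) / √(1 - α ^ 2)) := by
      have he : ∀ b ∈ Finset.univ.erase o, p b * r b
          = p b * (√(1 - β ^ 2) / √(1 - α ^ 2)) := fun b hb => by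
        simp only [hr]
        rw [if_neg (Finset.ne_of_mem_erase hb)]
      rw [Finset.sum_congr rfl he, ← Finset.sum_mul, hrest]
    have e2 : p o * r o = α * β := by
      simp only [hr, if_true, hp]
      rcases eq_or_ne α 0 with rfl | h
      · simp
      · field_simp
    have e3 : (1 - α ^ 2) * (√(1 - β ^ 2) / √(1 - α ^ 2)) = √(1 - β ^ 2) * √(1 - α ^ 2) := by
      rw [mul_div_left_comm, Real.div_sqrt]
    rw [e1, e2, e3]
    -- By AM-GM, `αβ + √(1 - β²) √(1 - α²) ≤ αβ + (2 - α² - β²) / 2`, which is the claimed bound.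
    have := sqrt_mul_sqrt_le (sub_nonneg.mpr hβ1) hα1
    linarith
  have hpt : ∀ b : Fin M → B, likelihood o α b ≤ likelihood o β b →
      ∏ j, p (b j) ≤ ∏ j, p (b j) * r (b j) := by
    intro b hb
    by_cases hz : ∏ j, p (b j) = 0
    · rw [hz]
      exact Finset.prod_nonneg fun j _ => mul_nonneg (h0 _) (hr0 _)
    have hpos : ∀ j, 0 < p (b j) := fun j =>
      lt_of_le_of_ne (h0 _) (Ne.symm (Finset.prod_ne_zero_iff.mp hz j (Finset.mem_univ j)))
    have hLpos : ∀ j, 0 < if b j = o then α ^ 2 else 1 - α ^ 2 := fun j => by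
      split_ifs with h
      · rw [← hp, ← h]
        exact hpos j
      · exact (hpos j).trans_le (hle _ h)
    have hrsq : (∏ j, r (b j)) ^ 2 = likelihood o β b / likelihood o α b := by
      rw [likelihood, likelihood, ← Finset.prod_pow, ← Finset.prod_div_distrib]
      refine Finset.prod_congr rfl fun j _ => ?_
      simp only [hr]
      split_ifs
      · rw [div_pow]
      · rw [div_pow, Real.sq_sqrt (sub_nonneg.mpr hβ1), Real.sq_sqrt hα1]
    have hr1 : 1 ≤ ∏ j, r (b j) := by
      have hq : 1 ≤ (∏ j, r (b j)) ^ 2 := by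
        have hL : 0 < likelihood o α b := Finset.prod_pos fun j _ => hLpos j
        rw [hrsq, one_le_div hL]
        exact hb
      rw [one_le_sq_iff_one_le_abs] at hq
      rwa [abs_of_nonneg (Finset.prod_nonneg fun j _ => hr0 _)] at hq
    rw [Finset.prod_mul_distrib]
    exact le_mul_of_one_le_right (Finset.prod_nonneg fun j _ => h0 _) hr1
  calc _ ≤ ∑ b ∈ Finset.univ.filter
        (fun b : Fin M → B => likelihood o α b ≤ likelihood o β b), ∏ j, p (b j) * r (b j) :=
        Finset.sum_le_sum fun b hb => hpt b (Finset.mem_filter.mp hb).2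
    _ ≤ ∑ b : Fin M → B, ∏ j, p (b j) * r (b j) :=
        Finset.sum_le_sum_of_subset_of_nonneg (Finset.subset_univ _) fun b _ _ =>
          Finset.prod_nonneg fun j _ => mul_nonneg (h0 _) (hr0 _)
    _ = (∑ b, p b * r b) ^ M := by rw [Fintype.sum_pow]
    _ ≤ _ := pow_le_pow_left₀ (Finset.sum_nonneg fun b _ => mul_nonneg (h0 _) (hr0 _)) hsum M

end Prob

/-! ### The two measurements -/

/-- The amplitudes of the phase state, as real numbers. -/
noncomputable def realPhaseState {n : ℕ} (f : Cube n → Bool) (x : Cube n) : ℝ :=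
  bitSign (f x) / √(2 ^ n)

lemma phaseState_eq {n : ℕ} (f : Cube n → Bool) :
    phaseState f = fun x => (realPhaseState f x : ℂ) := by
  funext x
  simp [phaseState, realPhaseState, bitSign]

lemma tensorPower_phaseState {n : ℕ} (f : Cube n → Bool) (M : ℕ) :
    tensorPower (phaseState f) M
      = fun y => ((∏ i, realPhaseState f (y i) : ℝ) : ℂ) := by
  funext y
  simp [tensorPower, phaseState_eq]

lemma sum_realPhaseState_sq {n : ℕ} (f : Cube n → Bool) : ∑ x, realPhaseState f x ^ 2 = 1 := by
  have h : ∀ x, realPhaseState f x ^ 2 = 1 / 2 ^ n := fun x => by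
    rw [realPhaseState, div_pow, Real.sq_sqrt (by positivity), sq, bitSign_mul_self]
  simp [h]

/-- The Fourier basis. -/
noncomputable def fourierVec {n : ℕ} (J : Finset (Fin n)) (x : Cube n) : ℝ :=
  character J x / √(2 ^ n)

lemma isFrame_fourierVec {n : ℕ} : IsFrame (fourierVec (n := n)) := by
  intro x y
  have h : ∀ J, fourierVec J x * fourierVec J y = character J x * character J y / 2 ^ n :=
    fun J => by
      rw [fourierVec, fourierVec, div_mul_div_comm, Real.mul_self_sqrt (by positivity)]
  simp only [h]
  rw [← Finset.sum_div, sum_character_mul_character]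
  split_ifs <;> simp

lemma sum_fourierVec_mul {n : ℕ} (f : Cube n → Bool) (J : Finset (Fin n)) :
    ∑ x, fourierVec J x * realPhaseState f x = amp f J := by
  rw [amp, Finset.sum_div]
  refine Finset.sum_congr rfl fun x _ => ?_
  rw [fourierVec, realPhaseState, div_mul_div_comm, Real.mul_self_sqrt (by positivity), mul_comm]

/-- The outcomes of the second measurement: `none` stands for a Fourier basis vector, and a bit for
a sum or difference of two of them. -/
abbrev Label (n : ℕ) : Type := Finset (Fin n) × Option Bool

/-- The combination of `v T` and `v (σ T)` that belongs to a label. -/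
noncomputable def labelComb {n : ℕ} (σ : Equiv.Perm (Finset (Fin n))) (v : Finset (Fin n) → ℝ) :
    Label n → ℝ
  | (T, none) => √(1 / 8) * (2 * v T)
  | (T, some b) => √(1 / 8) * (v T + bitSign b * v (σ T))

/-- The vectors of the second measurement, which compares `T` with `σ T`. -/
noncomputable def labelVec {n : ℕ} (σ : Equiv.Perm (Finset (Fin n))) (o : Label n)
    (x : Cube n) : ℝ :=
  labelComb σ (fun T => fourierVec T x) o

/-- The cross terms of sum and difference cancel, so `T` contributes weight `(4 + 2) / 8` at `T` and
`2 / 8` at `σ T`. As `σ` is a bijection, every Fourier vector gets total weight `1`. -/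
lemma isFrame_labelVec {n : ℕ} (σ : Equiv.Perm (Finset (Fin n))) : IsFrame (labelVec σ) := by
  intro x y
  have hs : √(1 / 8 : ℝ) * √(1 / 8) = 1 / 8 := Real.mul_self_sqrt (by norm_num)
  have h : ∀ T, ∑ k, labelVec σ (T, k) x * labelVec σ (T, k) y
      = 3 / 4 * (fourierVec T x * fourierVec T y)
        + 1 / 4 * (fourierVec (σ T) x * fourierVec (σ T) y) := by
    intro T
    rw [Fintype.sum_option, Fintype.sum_bool]
    simp only [labelVec, labelComb, bitSign, Bool.toNat_true, Bool.toNat_false, pow_one, pow_zero]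
    linear_combination (4 * fourierVec T x * fourierVec T y
      + (fourierVec T x + -1 * fourierVec (σ T) x) * (fourierVec T y + -1 * fourierVec (σ T) y)
      + (fourierVec T x + 1 * fourierVec (σ T) x) * (fourierVec T y + 1 * fourierVec (σ T) y)) * hs
  rw [Fintype.sum_prod_type]
  simp only [h]
  rw [Finset.sum_add_distrib, ← Finset.mul_sum, ← Finset.mul_sum,
    Equiv.sum_comp σ fun T => fourierVec T x * fourierVec T y, isFrame_fourierVec]
  split_ifs <;> norm_num

/-- The amplitude of the outcome `o` of the second measurement. -/
noncomputable def labelAmp {n : ℕ} (σ : Equiv.Perm (Finset (Fin n))) (f : Cube n → Bool)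
    (o : Label n) : ℝ :=
  labelComb σ (amp f) o

lemma sum_labelVec_mul {n : ℕ} (σ : Equiv.Perm (Finset (Fin n))) (f : Cube n → Bool)
    (o : Label n) : ∑ x, labelVec σ o x * realPhaseState f x = labelAmp σ f o := by
  rcases o with ⟨T, _ | b⟩
  · simp only [labelVec, labelAmp, labelComb, ← sum_fourierVec_mul, Finset.mul_sum]
    exact Finset.sum_congr rfl fun x _ => by ring
  · simp only [labelVec, labelAmp, labelComb, ← sum_fourierVec_mul, Finset.mul_sum,
      ← Finset.sum_add_distrib]
    exact Finset.sum_congr rfl fun x _ => by ring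

lemma sum_labelAmp_sq {n : ℕ} (σ : Equiv.Perm (Finset (Fin n))) (f : Cube n → Bool) :
    ∑ o, labelAmp σ f o ^ 2 = 1 := by
  simp only [← sum_labelVec_mul]
  rw [(isFrame_labelVec σ).sum_sq, sum_realPhaseState_sq]

/-- The possible absolute values of the amplitudes of the second measurement. -/
noncomputable def gridValue (d m : ℕ) : ℝ := √(1 / 8) * (m / 2 ^ d)

lemma gridValue_nonneg (d m : ℕ) : 0 ≤ gridValue d m := by
  unfold gridValue
  positivity

lemma gridValue_sq_le_one {d m : ℕ} (hm : m ≤ 2 ^ (d + 1)) : gridValue d m ^ 2 ≤ 1 := by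
  have h1 : (m : ℝ) / 2 ^ d ≤ 2 := by
    rw [div_le_iff₀ (by positivity), ← pow_succ']
    exact_mod_cast hm
  have h2 : ((m : ℝ) / 2 ^ d) ^ 2 ≤ 2 ^ 2 := pow_le_pow_left₀ (by positivity) h1 2
  rw [gridValue, mul_pow, Real.sq_sqrt (by norm_num)]
  linarith

/-- The separation is uniform in `m` and `k` since it concerns square roots of probabilities.
Estimating the probabilities to additive precision `4^(-d)` would suggest order `16^d` copies. -/
lemma le_gridValue_sub_sq {d m k : ℕ} (h : m ≠ k) :
    1 / (16 * 4 ^ d) ≤ (gridValue d m - gridValue d k) ^ 2 / 2 := by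
  have h1 : (1 : ℝ) ≤ ((m : ℝ) - k) ^ 2 := by
    have : (1 : ℤ) ≤ ((m : ℤ) - k) ^ 2 :=
      (one_le_sq_iff_one_le_abs _).mpr (Int.one_le_abs (by omega))
    exact_mod_cast this
  have h4 : (4 : ℝ) ^ d = (2 ^ d) ^ 2 := by rw [← pow_mul, mul_comm, pow_mul]; norm_num
  have h2 : (gridValue d m - gridValue d k) ^ 2 = 1 / 8 * (((m : ℝ) - k) ^ 2 / 4 ^ d) := by
    rw [gridValue, gridValue, ← mul_sub, ← sub_div, mul_pow, Real.sq_sqrt (by norm_num), div_pow,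
      h4]
  rw [h2, div_le_div_iff₀ (by positivity) (by norm_num)]
  have h5 : 1 / 8 * (((m : ℝ) - k) ^ 2 / 4 ^ d) * (16 * 4 ^ d) = 2 * ((m : ℝ) - k) ^ 2 := by
    field_simp
    ring
  linarith

/-- A label that is used for decoding: a single coefficient, or the sum of two. -/
def testLabel {n : ℕ} (T : Finset (Fin n)) (single : Bool) : Label n :=
  (T, if single then none else some false)

/-- Both `2 F_T` and `F_T + F_(σ T)` are multiples of `2^(-d)` of absolute value at most `2`, whence
the range `m ≤ 2^(d + 1)`. -/
lemma exists_gridValue {n d : ℕ} {f : Cube n → Bool} (hf : fourierDegree f ≤ d)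
    (σ : Equiv.Perm (Finset (Fin n))) (T : Finset (Fin n)) (single : Bool) :
    ∃ m ≤ 2 ^ (d + 1), gridValue d m = |labelAmp σ f (testLabel T single)| := by
  have hgrid : ∀ r : ℝ, |r| ≤ 2 → r * 2 ^ d ∈ intReals →
      ∃ m ≤ 2 ^ (d + 1), gridValue d m = |√(1 / 8) * r| := by
    intro r hr hint
    obtain ⟨z, hz⟩ := mem_intReals.mp hint
    have habs : ((z.natAbs : ℕ) : ℝ) = |r| * 2 ^ d := by
      rw [Nat.cast_natAbs, Int.cast_abs, hz, abs_mul, abs_of_pos (by positivity : (0 : ℝ) < 2 ^ d)]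
    refine ⟨z.natAbs, ?_, ?_⟩
    · have : ((z.natAbs : ℕ) : ℝ) ≤ 2 ^ (d + 1) := by
        rw [habs, pow_succ']
        exact mul_le_mul_of_nonneg_right hr (by positivity)
      exact_mod_cast this
    · rw [gridValue, habs, mul_div_cancel_right₀ _ (by positivity), abs_mul,
        abs_of_nonneg (Real.sqrt_nonneg _)]
  have hT := abs_amp_le_one f T
  have hT' := abs_amp_le_one f (σ T)
  have iT := amp_mul_two_pow_mem hf T
  have iT' := amp_mul_two_pow_mem hf (σ T)
  cases single
  · refine hgrid (amp f T + bitSign false * amp f (σ T)) ?_ ?_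
    · simp only [bitSign, Bool.toNat_false, pow_zero, one_mul]
      exact (abs_add_le _ _).trans (by linarith)
    · simp only [bitSign, Bool.toNat_false, pow_zero, one_mul, add_mul]
      exact add_mem iT iT'
  · refine hgrid (2 * amp f T) ?_ ?_
    · rw [abs_mul, abs_two]
      linarith
    · rw [two_mul, add_mul]
      exact add_mem iT iT

/-! ### Decoding -/

/-- A permutation for which the set of the given elements is a cycle. -/
noncomputable def cyclePerm {α : Type} [Fintype α] [DecidableEq α] {M : ℕ} (a : Fin M → α) :
    Equiv.Perm α :=
  (Finset.exists_cycleOn (Finset.univ.image a)).choose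

lemma isCycleOn_cyclePerm {α : Type} [Fintype α] [DecidableEq α] {M : ℕ} (a : Fin M → α) :
    (cyclePerm a).IsCycleOn (Finset.univ.image a) :=
  (Finset.exists_cycleOn (Finset.univ.image a)).choose_spec.1

/-- The function `g` explains the outcomes `a` and `b` of the two measurements: `a` shows its Fourier
support, and it is strictly the likeliest explanation for the frequency of each label. -/
def Explains {n M₁ M₂ : ℕ} (d : ℕ) (a : Fin M₁ → Finset (Fin n)) (b : Fin M₂ → Label n)
    (g : Cube n → Bool) : Prop :=
  fourierDegree g ≤ d ∧ ampSupport g = Finset.univ.image a ∧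
    ∀ T ∈ Finset.univ.image a, ∀ single, ∀ m ≤ 2 ^ (d + 1),
      gridValue d m ≠ |labelAmp (cyclePerm a) g (testLabel T single)| →
        likelihood (testLabel T single) (gridValue d m) b
          < likelihood (testLabel T single) |labelAmp (cyclePerm a) g (testLabel T single)| b

/-- If `f` and `g` predicted different values for a tested label, both on the grid, each would be
strictly likelier than the other. -/
lemma Explains.sameUpToComplement {n M₁ M₂ d : ℕ} {a : Fin M₁ → Finset (Fin n)}
    {b : Fin M₂ → Label n} {f g : Cube n → Bool} (hf : Explains d a b f)
    (hg : Explains d a b g) : SameUpToComplement f g := by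
  obtain ⟨hfd, hfs, hfl⟩ := hf
  obtain ⟨hgd, hgs, hgl⟩ := hg
  have heq : ∀ T ∈ Finset.univ.image a, ∀ single,
      |labelAmp (cyclePerm a) g (testLabel T single)|
        = |labelAmp (cyclePerm a) f (testLabel T single)| := by
    intro T hT single
    obtain ⟨m, hm, hme⟩ := exists_gridValue hfd (cyclePerm a) T single
    obtain ⟨k, hk, hke⟩ := exists_gridValue hgd (cyclePerm a) T single
    by_contra hne
    have l1 := hgl T hT single m hm (by rw [hme]; exact Ne.symm hne)
    have l2 := hfl T hT single k hk (by rw [hke]; exact hne)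
    rw [hme] at l1
    rw [hke] at l2
    exact lt_asymm l1 l2
  have hs8 : √(1 / 8 : ℝ) ≠ 0 := by positivity
  rw [← hfs] at heq
  refine sameUpToComplement_of_cycle (σ := cyclePerm a) (hfs ▸ isCycleOn_cyclePerm a)
    (hgs.trans hfs.symm) (fun T hT => ?_) (fun T hT => ?_)
  · have := sq_eq_sq_iff_abs_eq_abs _ _ |>.mpr (heq T hT true)
    simp only [labelAmp, testLabel, if_true, labelComb, mul_pow] at this
    have := mul_left_cancel₀ (pow_ne_zero 2 hs8) this
    linarith
  · have := sq_eq_sq_iff_abs_eq_abs _ _ |>.mpr (heq T hT false)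
    simp only [labelAmp, testLabel, Bool.false_eq_true, if_false, labelComb, mul_pow, bitSign,
      Bool.toNat_false, pow_zero, one_mul] at this
    exact mul_left_cancel₀ (pow_ne_zero 2 hs8) this

open Classical in
/-- The guess for the unknown function. -/
noncomputable def decode {n M₁ M₂ : ℕ} (d : ℕ)
    (ω : (Fin M₁ → Finset (Fin n)) × (Fin M₂ → Label n)) : Cube n → Bool :=
  if h : ∃ g, Explains d ω.1 ω.2 g then h.choose else fun _ => false

/-- Explanations are unique up to complement, so the arbitrary choice in `decode` does no harm. -/
lemma sameUpToComplement_decode {n M₁ M₂ d : ℕ}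
    {ω : (Fin M₁ → Finset (Fin n)) × (Fin M₂ → Label n)} {f : Cube n → Bool}
    (hf : Explains d ω.1 ω.2 f) : SameUpToComplement f (decode d ω) := by
  have h : ∃ g, Explains d ω.1 ω.2 g := ⟨f, hf⟩
  rw [decode, dif_pos h]
  exact hf.sameUpToComplement h.choose_spec

/-- The measurement of the Fourier basis on `M₁` copies, followed by the comparison of the
coefficients along a cycle through the observed support on `M₂` copies. -/
noncomputable def learner (n d M₁ M₂ : ℕ) : POVM (Fin (M₁ + M₂) → Cube n) (Cube n → Bool) :=
  POVM.ofFrame (adaptiveVec (M₂ := M₂) fourierVec fun a : Fin M₁ → Finset (Fin n) =>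
    labelVec (cyclePerm a)) (isFrame_adaptiveVec isFrame_fourierVec fun _ => isFrame_labelVec _)
    (decode d)

open Classical in
lemma identifyProb_learner {n : ℕ} (d M₁ M₂ : ℕ) (f : Cube n → Bool) :
    identifyProb (learner n d M₁ M₂) f = ∑ a : Fin M₁ → Finset (Fin n), (∏ i, amp f (a i) ^ 2) *
      ∑ b ∈ Finset.univ.filter fun b : Fin M₂ → Label n => SameUpToComplement f (decode d (a, b)),
        ∏ j, labelAmp (cyclePerm a) f (b j) ^ 2 := by
  have h : ∀ g, (learner n d M₁ M₂).prob (tensorPower (phaseState f) (M₁ + M₂)) g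
      = ∑ a : Fin M₁ → Finset (Fin n), ∑ b : Fin M₂ → Label n, if decode d (a, b) = g then
        (∏ i, amp f (a i) ^ 2) * ∏ j, labelAmp (cyclePerm a) f (b j) ^ 2 else 0 := by
    intro g
    rw [tensorPower_phaseState, learner, POVM.prob_ofFrame, Finset.sum_filter,
      Fintype.sum_prod_type]
    refine Finset.sum_congr rfl fun a _ => Finset.sum_congr rfl fun b _ => ?_
    rw [sum_adaptiveVec_mul]
    simp only [sum_fourierVec_mul, sum_labelVec_mul, mul_pow, Finset.prod_pow]
  rw [identifyProb]
  simp only [h]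
  rw [Finset.sum_comm]
  refine Finset.sum_congr rfl fun a _ => ?_
  rw [Finset.sum_comm, Finset.sum_filter, Finset.mul_sum]
  refine Finset.sum_congr rfl fun b _ => ?_
  rw [Finset.sum_ite_eq]
  simp

lemma pow_le_exp_of_le {x c : ℝ} {k M : ℕ} (hx0 : 0 ≤ x) (hc : 0 < c) (hx : x ≤ 1 - 1 / c)
    (hM : k * c ≤ M) : x ^ M ≤ Real.exp (-1) ^ k := by
  have h1 : x ≤ Real.exp (-(1 / c)) := hx.trans (by
    have := Real.add_one_le_exp (-(1 / c))
    linarith)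
  calc x ^ M ≤ Real.exp (-(1 / c)) ^ M := pow_le_pow_left₀ hx0 h1 M
    _ = Real.exp (-(M / c)) := by
      rw [← Real.exp_nat_mul]
      congr 1
      ring
    _ ≤ Real.exp (-k) := Real.exp_le_exp.mpr (neg_le_neg ((le_div_iff₀ hc).mpr hM))
    _ = _ := by
      rw [← Real.exp_nat_mul]
      congr 1
      ring

/-- Calibrated for the larger union bound: at most `6 * 8^d` tests leave total error `1 / 6`. -/
lemma exp_neg_one_pow_le (d : ℕ) : Real.exp (-1) ^ (4 * (d + 1)) ≤ (1 / 36) * (1 / 8) ^ d := by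
  have h0 : Real.exp (-1) < 0.37 := by
    have := Real.exp_neg_one_lt_d9
    linarith
  have h1 : Real.exp (-1) ^ 4 ≤ 1 / 36 := by
    calc Real.exp (-1) ^ 4 ≤ 0.37 ^ 4 := pow_le_pow_left₀ (Real.exp_pos _).le h0.le 4
      _ ≤ 1 / 36 := by norm_num
  rw [pow_mul, pow_succ']
  exact mul_le_mul h1 (pow_le_pow_left₀ (by positivity) (h1.trans (by norm_num)) d) (by positivity)
    (by norm_num)

-- Coupon collector: each of at most `4^d` sets of the support is missed with probability at most
-- `(1 - 4^(-d))^M`.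
open Classical in
lemma five_sixths_le_support {n d M : ℕ} {f : Cube n → Bool} (hf : fourierDegree f ≤ d)
    (hM : 4 * (d + 1) * 4 ^ d ≤ M) :
    5 / 6 ≤ ∑ a ∈ Finset.univ.filter
      (fun a : Fin M → Finset (Fin n) => (∏ i, amp f (a i) ^ 2 ≠ 0) ∧ ampSupport f = Finset.univ.image a),
      ∏ i, amp f (a i) ^ 2 := by
  have hex : ∀ a : Fin M → Finset (Fin n), 0 ≤ ∏ i, amp f (a i) ^ 2 := fun a =>
    Finset.prod_nonneg fun i _ => sq_nonneg _
  -- Weakening the conjunction to an implication adds only samples of weight `0`. Samples of nonzero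
  -- weight never leave the support, so only missed sets remain to be excluded.
  have hdrop : ∑ a ∈ Finset.univ.filter
      (fun a : Fin M → Finset (Fin n) => (∏ i, amp f (a i) ^ 2 ≠ 0) ∧ ampSupport f = Finset.univ.image a),
      ∏ i, amp f (a i) ^ 2 = ∑ a ∈ Finset.univ.filter
      (fun a : Fin M → Finset (Fin n) => ∏ i, amp f (a i) ^ 2 ≠ 0 → ampSupport f = Finset.univ.image a),
      ∏ i, amp f (a i) ^ 2 := by
    refine Finset.sum_subset (fun a ha => ?_) (fun a ha hna => ?_)
    · simp only [Finset.mem_filter] at ha ⊢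
      exact ⟨ha.1, fun _ => ha.2.2⟩
    · simp only [Finset.mem_filter, not_and] at ha hna
      by_contra h
      exact hna ha.1 h (ha.2 h)
  rw [hdrop]
  refine le_trans ?_ (one_sub_sum_le_sum_filter hex (sum_prod_eq_one (sum_amp_sq f) M)
    (ampSupport f) (fun J a => ∀ j, a j ≠ J) _ ?_)
  · have hterm : ∀ J ∈ ampSupport f, ∑ a ∈ Finset.univ.filter
        (fun a : Fin M → Finset (Fin n) => ∀ j, a j ≠ J), ∏ i, amp f (a i) ^ 2
        ≤ Real.exp (-1) ^ (4 * (d + 1)) := by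
      intro J hJ
      rw [sum_filter_notMem_range (sum_amp_sq f)]
      have h1 : amp f J ^ 2 ≤ 1 := (sq_le_one_iff_abs_le_one _).mpr (abs_amp_le_one f J)
      have h2 := le_amp_sq hf hJ
      refine pow_le_exp_of_le (c := 4 ^ d) (by linarith) (by positivity) ?_ (by exact_mod_cast hM)
      rw [one_div]
      linarith
    have h1 := (Finset.sum_le_card_nsmul _ _ _ hterm)
    rw [nsmul_eq_mul] at h1
    have h2 : ((ampSupport f).card : ℝ) * Real.exp (-1) ^ (4 * (d + 1))
        ≤ 4 ^ d * (1 / 36 * (1 / 8) ^ d) :=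
      mul_le_mul (card_ampSupport_le hf) (exp_neg_one_pow_le d) (by positivity) (by positivity)
    have h3 : (4 : ℝ) ^ d * (1 / 36 * (1 / 8) ^ d) = 1 / 36 * (1 / 2) ^ d := by
      rw [mul_left_comm, ← mul_pow]
      norm_num
    have h4 : ((1 : ℝ) / 2) ^ d ≤ 1 := pow_le_one₀ (by norm_num) (by norm_num)
    linarith
  · intro a ha hne
    ext J
    rw [mem_ampSupport, Finset.mem_image]
    constructor
    · intro hJ
      have := ha J (mem_ampSupport.mpr hJ)
      push Not at this
      obtain ⟨j, hj⟩ := this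
      exact ⟨j, Finset.mem_univ j, hj⟩
    · rintro ⟨j, -, rfl⟩
      exact fun h0 => Finset.prod_ne_zero_iff.mp hne j (Finset.mem_univ j) (by rw [h0]; simp)

-- A union bound over the triples of a set in the support, a kind of label and a wrong grid value.
-- If the true value strictly wins every test, `f` itself explains the outcomes.
open Classical in
lemma five_sixths_le_decode {n d M₁ M₂ : ℕ} {f : Cube n → Bool} (hf : fourierDegree f ≤ d)
    (hM : 64 * (d + 1) * 4 ^ d ≤ M₂) {a : Fin M₁ → Finset (Fin n)}
    (ha : ampSupport f = Finset.univ.image a) :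
    5 / 6 ≤ ∑ b ∈ Finset.univ.filter
      (fun b : Fin M₂ → Label n => SameUpToComplement f (decode d (a, b))),
        ∏ j, labelAmp (cyclePerm a) f (b j) ^ 2 := by
  set σ := cyclePerm a with hσ
  refine le_trans ?_ (one_sub_sum_le_sum_filter
    (fun b => Finset.prod_nonneg fun j _ => sq_nonneg _)
    (sum_prod_eq_one (sum_labelAmp_sq σ f) M₂)
    ((ampSupport f ×ˢ (Finset.univ : Finset Bool)) ×ˢ Finset.range (2 ^ (d + 1) + 1))
    (fun i b => gridValue d i.2 ≠ |labelAmp σ f (testLabel i.1.1 i.1.2)| ∧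
      likelihood (testLabel i.1.1 i.1.2) |labelAmp σ f (testLabel i.1.1 i.1.2)| b
        ≤ likelihood (testLabel i.1.1 i.1.2) (gridValue d i.2) b) _ ?_)
  · have hterm : ∀ i ∈ (ampSupport f ×ˢ (Finset.univ : Finset Bool)) ×ˢ
        Finset.range (2 ^ (d + 1) + 1), ∑ b ∈ Finset.univ.filter (fun b : Fin M₂ → Label n =>
          gridValue d i.2 ≠ |labelAmp σ f (testLabel i.1.1 i.1.2)| ∧
          likelihood (testLabel i.1.1 i.1.2) |labelAmp σ f (testLabel i.1.1 i.1.2)| b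
            ≤ likelihood (testLabel i.1.1 i.1.2) (gridValue d i.2) b),
          ∏ j, labelAmp σ f (b j) ^ 2 ≤ Real.exp (-1) ^ (4 * (d + 1)) := by
      rintro ⟨⟨T, single⟩, m⟩ hi
      have hm : m ≤ 2 ^ (d + 1) := Nat.lt_succ_iff.mp (Finset.mem_range.mp (Finset.mem_product.mp hi).2)
      obtain ⟨k, hk, hke⟩ := exists_gridValue hf σ T single
      simp only
      by_cases hne : gridValue d m = |labelAmp σ f (testLabel T single)|
      · simp only [hne, ne_eq, not_true, false_and, Finset.filter_false, Finset.sum_empty]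
        positivity
      have hmk : k ≠ m := by
        rintro rfl
        exact hne hke
      simp only [ne_eq, hne, not_false_iff, true_and]
      refine (sum_filter_likelihood_le (fun o => sq_nonneg (labelAmp σ f o)) (sum_labelAmp_sq σ f)
        M₂ _ (abs_nonneg _) (gridValue_nonneg d m) (gridValue_sq_le_one hm)
        (sq_abs _).symm).trans ?_
      rw [← hke]
      have hgap := le_gridValue_sub_sq (d := d) hmk
      -- The gap is `1 / (16 * 4^d)`, so `64 (d + 1) 4^d` copies give the exponent `4 (d + 1)`.
      refine pow_le_exp_of_le (c := 16 * 4 ^ d) ?_ (by positivity) (by linarith) ?_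
      · nlinarith [gridValue_sq_le_one hm, gridValue_sq_le_one hk,
          mul_nonneg (gridValue_nonneg d k) (gridValue_nonneg d m)]
      · have : ((64 * (d + 1) * 4 ^ d : ℕ) : ℝ) ≤ M₂ := by exact_mod_cast hM
        push_cast at this ⊢
        linarith
    have h1 := Finset.sum_le_card_nsmul _ _ _ hterm
    rw [nsmul_eq_mul, Finset.card_product, Finset.card_product, Finset.card_range] at h1
    push_cast [Finset.card_univ, Fintype.card_bool] at h1
    have hone : (1 : ℝ) ≤ 2 ^ d := one_le_pow₀ (by norm_num)
    have h2 : ((ampSupport f).card : ℝ) * 2 * (2 ^ (d + 1) + 1) ≤ 4 ^ d * 2 * (3 * 2 ^ d) := by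
      refine mul_le_mul (mul_le_mul_of_nonneg_right (card_ampSupport_le hf) (by norm_num)) ?_
        (by positivity) (by positivity)
      rw [pow_succ]
      linarith
    have h3 := mul_le_mul h2 (exp_neg_one_pow_le d) (by positivity) (by positivity)
    have h4 : (4 : ℝ) ^ d * 2 * (3 * 2 ^ d) * (1 / 36 * (1 / 8) ^ d)
        = 1 / 6 * (4 * 2 * (1 / 8)) ^ d := by
      rw [mul_pow, mul_pow]
      ring
    have h5 : (1 : ℝ) / 6 * (4 * 2 * (1 / 8)) ^ d = 1 / 6 := by norm_num
    linarith
  · intro b hb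
    refine sameUpToComplement_decode ⟨hf, ha, fun T hT single m hm hne => ?_⟩
    by_contra hle
    exact hb ((T, single), m) (by simp [ha ▸ hT, hm]) ⟨hne, not_lt.mp hle⟩

lemma two_thirds_le_identifyProb {n d M₁ M₂ : ℕ} (h₁ : 4 * (d + 1) * 4 ^ d ≤ M₁)
    (h₂ : 64 * (d + 1) * 4 ^ d ≤ M₂) {f : Cube n → Bool} (hf : fourierDegree f ≤ d) :
    2 / 3 ≤ identifyProb (learner n d M₁ M₂) f := by
  classical
  rw [identifyProb_learner]
  have hs := five_sixths_le_support (n := n) hf h₁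
  have hnn : ∀ a : Fin M₁ → Finset (Fin n), 0 ≤ ∏ i, amp f (a i) ^ 2 := fun a =>
    Finset.prod_nonneg fun i _ => sq_nonneg _
  calc (2 / 3 : ℝ) ≤ 5 / 6 * (5 / 6) := by norm_num
    _ ≤ (∑ a ∈ Finset.univ.filter (fun a : Fin M₁ → Finset (Fin n) =>
          (∏ i, amp f (a i) ^ 2 ≠ 0) ∧ ampSupport f = Finset.univ.image a),
          ∏ i, amp f (a i) ^ 2) * (5 / 6) := by
        refine mul_le_mul_of_nonneg_right ?_ (by norm_num)
        convert hs
    _ ≤ _ := by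
        rw [Finset.sum_mul]
        refine (Finset.sum_le_sum fun a ha => ?_).trans
          (Finset.sum_le_sum_of_subset_of_nonneg (Finset.subset_univ _) fun a _ _ =>
            mul_nonneg (hnn a) (Finset.sum_nonneg fun b _ =>
              Finset.prod_nonneg fun j _ => sq_nonneg _))
        refine mul_le_mul_of_nonneg_left ?_ (hnn a)
        refine five_sixths_le_decode hf h₂ ?_
        convert (Finset.mem_filter.mp ha).2.2

end PhaseState

theorem mainTheorem6 :
    ∃ C a : ℕ, ∀ n d M : ℕ, C * (d + 1) ^ a * 2 ^ (2 * d) ≤ M →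
      ∃ E : PhaseState.POVM (Fin M → PhaseState.Cube n) (PhaseState.Cube n → Bool),
        ∀ f : PhaseState.Cube n → Bool, PhaseState.fourierDegree f ≤ d →
          2 / 3 ≤ PhaseState.identifyProb E f := by
  -- `68 = 4 + 64`, for the two stages. The first uses exactly `4 (d + 1) 4^d` copies and the second
  -- all the others, so that every larger `M` is covered.
  refine ⟨68, 1, fun n d M hM => ?_⟩
  have h4 : 2 ^ (2 * d) = 4 ^ d := by rw [pow_mul]; norm_num
  rw [pow_one, h4] at hM
  have hM' : 4 * (d + 1) * 4 ^ d + 64 * (d + 1) * 4 ^ d ≤ M := by linarith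
  obtain ⟨M₂, rfl⟩ := Nat.exists_eq_add_of_le (le_of_add_le_left hM')
  exact ⟨PhaseState.learner n d _ M₂, fun f hf =>
    PhaseState.two_thirds_le_identifyProb le_rfl (by linarith) hf⟩
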